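/- Let $G$ be a finite simple graph that is connected and not Hamiltonian (i.e. $G$ has no spanning cycle). Let $\kappa(G)$ be its (vertex) connectivity, i.e. the least number of vertices whose deletion leaves a disconnected graph or a graph with at most one vertex, and let $\alpha(G)$ be its independence number. If $|V(G)| \ge 3\kappa(G)+3$, every vertex of $G$ has degree at least $2$, and $\alpha(G) \le \kappa(G)+1$, then $G$ has a 2-factor (a spanning subgraph in which every vertex has degree $2$) with exactly two connected components. -/

import Mathlib

namespace SimpleGraph

/-- The (vertex) connectivity `κ(G)` of a finite simple graph: the least number of vertices whose
deletion leaves a disconnected graph or a graph with at most one vertex. In particular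
`κ(G) = |V(G)| - 1` when `G` is complete (and nonempty), and `κ(G) = 0` when `G` is disconnected. -/
noncomputable def vertexConnectivity {V : Type*} [Fintype V] (G : SimpleGraph V) : ℕ :=
  sInf {k | ∃ S : Finset V, S.card = k ∧
    (¬ (G.induce {v | v ∉ S}).Preconnected ∨ Fintype.card V ≤ S.card + 1)}

/-- `H` is a 2-factor of `G`: a spanning subgraph of `G` (same vertex set, edges among those
of `G`) in which every vertex has degree 2. -/
def IsTwoFactor {V : Type*} (G H : SimpleGraph V) : Prop :=
  H ≤ G ∧ ∀ v, (H.neighborSet v).ncard = 2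

end SimpleGraph

/-! The proof refines the Chvátal–Erdős rerouting argument. Among all pairs of a longest cycle C and
a connected vertex set K off C, take one with |K| maximal. Let S be the set of vertices of C with a
neighbour in K (`attach`), and write v⁺ for the successor of v on C (`C.formPerm v`). Rerouting C
through K would give a longer cycle unless S⁺ together with any h in K is independent; and S
separates K from the rest of C, so |S| ≥ κ. As α ≤ κ + 1, this independent set is maximum, and every
vertex outside it has a neighbour in it. All later contradictions come from this forced adjacency,
also after exchanging one element of the set.

It follows that K contains every vertex off C (`covers`), that |S| = κ, and that K is a clique
(`adj_of_mem`). If |K| ≥ 3, then C and a cycle through K form the 2-factor. If |K| ≤ 2, then |C| ≥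
3κ + 1, so some segment T of C avoiding S has at least three vertices. Either the ends of T are
adjacent, and T closes to a cycle while the rest of C closes through all of K
(`exists_spanning_ear`), or another pair of cycles covers the graph
(`ends_adj_or_exists_isTwoFactor`). -/

namespace SimpleGraph

/-! ### Paths and cycles as vertex lists. -/

variable {V : Type*} {G : SimpleGraph V} {a b c d s t u v : V} {l l' A B C X Y : List V}

/-- `l` lists the vertices of a walk of `G` from `a` to `b`. -/
structure PathL (G : SimpleGraph V) (a b : V) (l : List V) : Prop where
  chain : l.IsChain G.Adj
  head : l.head? = some a
  last : l.getLast? = some b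

/-- `l` lists the vertices of a cycle of `G`. -/
structure CycL (G : SimpleGraph V) (l : List V) : Prop where
  nodup : l.Nodup
  three_le : 3 ≤ l.length
  closed : ∃ a b, PathL G a b l ∧ G.Adj b a

theorem PathL.single (a : V) : PathL G a a [a] := ⟨by simp, by simp, by simp⟩

theorem PathL.ne_nil (h : PathL G a b l) : l ≠ [] := by
  rintro rfl; simpa using h.head

theorem PathL.append (h : PathL G a b l) (h' : PathL G c d l') (hbc : G.Adj b c) :
    PathL G a d (l ++ l') := by
  refine ⟨?_, ?_, ?_⟩
  · rw [List.isChain_append]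
    refine ⟨h.chain, h'.chain, ?_⟩
    rw [h.last, h'.head]
    simpa using hbc
  · simp [List.head?_append, h.head]
  · simp [List.getLast?_append, h'.last]

theorem PathL.reverse (h : PathL G a b l) : PathL G b a l.reverse := by
  refine ⟨?_, by simp [h.last], by simp [h.head]⟩
  rw [List.isChain_reverse]
  exact h.chain.imp fun _ _ h => h.symm

theorem PathL.eq_cons (h : PathL G a b l) : ∃ l', l = a :: l' := by
  have := h.head
  cases l with
  | nil => simp at this
  | cons x l => simp at this; subst this; exact ⟨l, rfl⟩

theorem PathL.eq_concat (h : PathL G a b l) : ∃ l', l = l' ++ [b] := by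
  obtain ⟨l', h'⟩ := h.reverse.eq_cons
  exact ⟨l'.reverse, by simpa using congrArg List.reverse h'⟩

theorem PathL.head_mem (h : PathL G a b l) : a ∈ l := by
  obtain ⟨l', rfl⟩ := h.eq_cons; simp

theorem PathL.last_mem (h : PathL G a b l) : b ∈ l := by
  obtain ⟨l', rfl⟩ := h.eq_concat; simp

theorem PathL.split (h : PathL G a b (X ++ u :: c :: Y)) :
    PathL G a u (X ++ [u]) ∧ PathL G c b (c :: Y) ∧ G.Adj u c := by
  obtain ⟨h1, h2, h3⟩ := h
  rw [List.isChain_append_cons_cons] at h1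
  refine ⟨⟨h1.1, ?_, by simp⟩, ⟨h1.2.2, by simp, ?_⟩, h1.2.1⟩
  · cases X <;> simpa using h2
  · simpa using h3

theorem PathL.suffix (h : PathL G a b (X ++ c :: Y)) : PathL G c b (c :: Y) := by
  obtain ⟨h1, h2, h3⟩ := h
  exact ⟨h1.right_of_append, by simp, by simpa using h3⟩

theorem PathL.prefix (h : PathL G a b (X ++ c :: Y)) : PathL G a c (X ++ [c]) := by
  have h' : PathL G c a (c :: X.reverse) :=
    PathL.suffix (X := Y.reverse) (by simpa using h.reverse)
  simpa using h'.reverse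

theorem PathL.exists_split (h : PathL G a b l) (ht : t ∈ l) (hne : t ≠ b) :
    ∃ A c B, l = A ++ t :: c :: B := by
  obtain ⟨A, B, rfl⟩ := List.append_of_mem ht
  cases B with
  | nil => simpa [hne] using h.last
  | cons c B => exact ⟨A, c, B, rfl⟩

theorem PathL.exists_nodup (h : PathL G a b l) : ∃ l', PathL G a b l' ∧ l'.Nodup ∧ l' ⊆ l := by
  induction l generalizing a with
  | nil => simpa using h.head
  | cons x l ih =>
    obtain rfl : x = a := by simpa using h.head
    cases l with
    | nil => exact ⟨[x], h, by simp, by simp⟩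
    | cons y l =>
      obtain ⟨-, h2, h3⟩ := PathL.split (X := []) h
      obtain ⟨m, hm, hn, hs⟩ := ih h2
      by_cases hx : x ∈ m
      · obtain ⟨A, B, rfl⟩ := List.append_of_mem hx
        exact ⟨x :: B, hm.suffix, (List.nodup_append.1 hn).2.1,
          fun z hz => List.mem_cons_of_mem _ (hs (by simp only [List.mem_append]; exact .inr hz))⟩
      · exact ⟨[x] ++ m, (PathL.single x).append hm h3, by simp [hx, hn],
          List.cons_subset_cons x hs⟩

theorem CycL.mk' (h : PathL G a b l) (hba : G.Adj b a) (hn : l.Nodup) (h3 : 3 ≤ l.length) :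
    CycL G l := ⟨hn, h3, a, b, h, hba⟩

theorem CycL.rotate_append (h : CycL G (X ++ Y)) : CycL G (Y ++ X) := by
  obtain ⟨hn, h3, a, b, hp, hba⟩ := h
  have hp' := List.perm_append_comm (l₁ := X) (l₂ := Y)
  rcases X.eq_nil_or_concat with rfl | ⟨X, u, rfl⟩
  · simpa using CycL.mk' hp hba hn h3
  · cases Y with
    | nil => simpa using CycL.mk' hp hba hn h3
    | cons c Y =>
      obtain ⟨h1, h2, h4⟩ := PathL.split (by simpa using hp)
      refine CycL.mk' (h2.append (by simpa using h1) hba) h4 (hp'.nodup_iff.1 hn) ?_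
      rwa [← hp'.length_eq]

theorem CycL.rotated (h : CycL G l) (hl : l' ~r l) : CycL G l' := by
  obtain ⟨n, hn, rfl⟩ := List.isRotated_iff_mod.1 hl.symm
  rw [List.rotate_eq_drop_append_take hn]
  apply CycL.rotate_append
  simpa using h

/-! ### The successor map `C.formPerm` of a cycle. -/

variable [DecidableEq V]

theorem formPerm_eq_of_consecutive (hn : C.Nodup) (h : (X ++ u :: c :: Y) ~r C) :
    C.formPerm u = c := by
  have h2 : (u :: c :: (Y ++ X)) ~r C := by
    refine List.IsRotated.trans ?_ h
    simpa using List.isRotated_append (l := u :: c :: Y) (l' := X)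
  have hn2 := h2.perm.nodup_iff.2 hn
  rw [← List.formPerm_eq_of_isRotated hn2 h2]
  exact List.formPerm_apply_head _ _ _ hn2

theorem PathL.formPerm_last (hp : PathL G a b l) (hn : C.Nodup) (h : l ~r C) :
    C.formPerm b = a := by
  have hn2 := h.perm.nodup_iff.2 hn
  rw [← List.formPerm_eq_of_isRotated hn2 h]
  obtain ⟨l', rfl⟩ := hp.eq_cons
  have := List.formPerm_apply_getLast a l'
  rwa [(List.getLast_eq_iff_getLast?_eq_some (by simp)).2 hp.last] at this

theorem CycL.exists_rotation (h : CycL G C) (hs : s ∈ C) :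
    ∃ L, L ~r C ∧ PathL G (C.formPerm s) s L ∧ G.Adj s (C.formPerm s) := by
  obtain ⟨X, Y, rfl⟩ := List.append_of_mem hs
  have hr : (Y ++ (X ++ [s])) ~r (X ++ s :: Y) := by
    simpa using List.isRotated_append (l := Y) (l' := X ++ [s])
  have hc := h.rotated hr
  obtain ⟨a, b, hp, hba⟩ := hc.closed
  obtain rfl : s = b := by
    have := hp.last
    rw [← List.append_assoc] at this
    simpa using this
  rw [hp.formPerm_last h.nodup hr]
  exact ⟨_, hr, hp, hba⟩

/-- Cutting the cycle after s and after t leaves the arcs s⁺…t and t⁺…s, the pieces used in every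
rerouting. -/
theorem CycL.exists_split (h : CycL G C) (hs : s ∈ C) (ht : t ∈ C) (hne : s ≠ t) :
    ∃ A B, (A ++ B) ~r C ∧ PathL G (C.formPerm s) t A ∧ PathL G (C.formPerm t) s B := by
  obtain ⟨L, hL, hp, -⟩ := h.exists_rotation hs
  obtain ⟨A, c, B, rfl⟩ := hp.exists_split (hL.perm.mem_iff.2 ht) hne.symm
  obtain rfl := formPerm_eq_of_consecutive h.nodup hL
  obtain ⟨h1, h2, -⟩ := hp.split
  exact ⟨A ++ [t], _, by simpa using hL, h1, h2⟩

theorem CycL.formPerm_mem (hs : s ∈ C) : C.formPerm s ∈ C :=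
  List.formPerm_apply_mem_of_mem hs

theorem CycL.isHamiltonian [Fintype V] (h : CycL G C) (hC : ∀ v, v ∈ C) : G.IsHamiltonian := by
  intro _
  obtain ⟨hn, h3, a, b, hp, hba⟩ := h
  have ha : C.head hp.ne_nil = a := (List.head_eq_iff_head?_eq_some _).2 hp.head
  have hb : C.getLast hp.ne_nil = b := (List.getLast_eq_iff_getLast?_eq_some _).2 hp.last
  let q : G.Walk a b := (Walk.ofSupport C hp.ne_nil hp.chain).copy ha hb
  have hq : q.support = C := by simp [q]
  have hcard : C.length = Fintype.card V := by
    rw [← List.toFinset_card_of_nodup hn]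
    congr 1
    ext v; simpa using hC v
  have hl : q.length + 1 = C.length := by rw [← q.length_support, hq]
  refine ⟨b, .cons hba q, ?_⟩
  rw [Walk.isHamiltonianCycle_iff_isCycle_and_length_eq,
    Walk.isCycle_iff_isPath_tail_and_le_length]
  refine ⟨⟨?_, by simp; omega⟩, by simp; omega⟩
  rw [Walk.isPath_def, Walk.support_tail_of_not_nil _ (by simp)]
  simpa [hq] using hn

end SimpleGraph

/-! ### Gaps, linked sets, connectivity bounds, and 2-factors from two cycles. -/

namespace SimpleGraph

variable {V : Type*} {G : SimpleGraph V} {a b c d s t u v : V} {l l' A B C X Y : List V}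

theorem exists_maximal_of_le {α : Type*} {P : α → Prop} {f : α → ℕ} {N : ℕ}
    (hb : ∀ a, P a → f a ≤ N) (h : ∃ a, P a) : ∃ a, P a ∧ ∀ b, P b → f b ≤ f a := by
  have hbdd : BddAbove (f '' {a | P a}) := ⟨N, by rintro _ ⟨a, ha, rfl⟩; exact hb a ha⟩
  obtain ⟨a, ha, he⟩ := Nat.sSup_mem (Set.Nonempty.image f h) hbdd
  exact ⟨a, ha, fun b hb => he ▸ le_csSup hbdd ⟨b, hb, rfl⟩⟩

/-- A list whose last element satisfies `p` and in which elements satisfying `p` are sparse has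
three elements in a row, directly after such an element or at the start, none satisfying `p`. -/
theorem exists_long_gap {α : Type*} (p : α → Prop) [DecidablePred p] (l : List α)
    (hl : ∀ x ∈ l.getLast?, p x) (hc : 3 * l.countP p < l.length) :
    ∃ X T s Y, l = X ++ T ++ s :: Y ∧ (∀ x ∈ T, ¬ p x) ∧ p s ∧ 3 ≤ T.length ∧
      ∀ x ∈ X.getLast?, p x := by
  induction h : l.length using Nat.strong_induction_on generalizing l with
  | _ n ih =>
    subst h
    obtain ⟨T, s, Y, rfl, hT, hs⟩ : ∃ T s Y, l = T ++ s :: Y ∧ (∀ x ∈ T, ¬ p x) ∧ p s := by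
      have hlast : ∃ x ∈ l, p x := by
        rcases l.eq_nil_or_concat with rfl | ⟨l', x, rfl⟩
        · simp at hc
        · exact ⟨x, by simp, hl x (by simp)⟩
      clear hc hl ih
      induction l with
      | nil => simp at hlast
      | cons x l ih =>
        by_cases hx : p x
        · exact ⟨[], x, l, by simp, by simp, hx⟩
        · obtain ⟨T, s, Y, rfl, hT, hs⟩ := ih (by simpa [hx] using hlast)
          exact ⟨x :: T, s, Y, by simp, by simpa [hx] using hT, hs⟩
    by_cases h3 : 3 ≤ T.length
    · exact ⟨[], T, s, Y, by simp, hT, hs, h3, by simp⟩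
    · have hcT : T.countP p = 0 := by
        rw [List.countP_eq_zero]
        simpa using hT
      simp only [List.countP_append, hcT, List.countP_cons, List.length_append,
        List.length_cons, hs, decide_true, if_true] at hc
      obtain ⟨X, T', s', Y', rfl, h1, h2, h3', h4⟩ := ih Y.length (by simp; omega) Y
        (by
          intro x hx
          refine hl x ?_
          simp only [Option.mem_def] at hx
          simp [List.getLast?_cons, hx]) (by omega) rfl
      refine ⟨T ++ s :: X, T', s', Y', by simp, h1, h2, h3', ?_⟩
      intro x hx
      cases hX : X.getLast? with
      | none => simp [List.getLast?_cons, hX] at hx; exact hx ▸ hs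
      | some y => simp [List.getLast?_cons, hX] at hx; exact h4 x (by simp [hX, hx])

/-- Any two vertices of `K` are joined by a walk inside `K`. -/
def Linked (G : SimpleGraph V) (K : Finset V) : Prop :=
  ∀ x ∈ K, ∀ y ∈ K, ∃ l, PathL G x y l ∧ ∀ z ∈ l, z ∈ K

theorem Linked.exists_nodup {K : Finset V} (hK : Linked G K) {x y : V} (hx : x ∈ K) (hy : y ∈ K) :
    ∃ l, PathL G x y l ∧ l.Nodup ∧ ∀ z ∈ l, z ∈ K := by
  obtain ⟨l, hl, hs⟩ := hK x hx y hy
  obtain ⟨l', h1, h2, h3⟩ := hl.exists_nodup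
  exact ⟨l', h1, h2, fun z hz => hs z (h3 hz)⟩

theorem linked_singleton (x : V) : Linked G {x} := by
  intro y hy z hz
  rw [Finset.mem_singleton] at hy hz
  subst hy; subst hz
  exact ⟨[_], .single _, by simp⟩

theorem CycL.length_le [Fintype V] (h : CycL G C) : C.length ≤ Fintype.card V :=
  h.nodup.length_le_card

/-- All neighbours of an end of a longest path lie on the path; one that is not the next vertex
closes a cycle. -/
theorem exists_cycL [Fintype V] [Nonempty V] [DecidableRel G.Adj] (h : 2 ≤ G.minDegree) :
    ∃ C, CycL G C := by
  classical
  obtain ⟨l, ⟨hn, a, b, hp⟩, hmax⟩ := exists_maximal_of_le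
    (P := fun l : List V => l.Nodup ∧ ∃ a b, PathL G a b l) (f := List.length)
    (N := Fintype.card V) (fun l hl => hl.1.length_le_card)
    ⟨[Classical.arbitrary V], by simp, _, _, .single _⟩
  obtain ⟨m, rfl⟩ := hp.eq_cons
  have hin : ∀ u, G.Adj a u → u ∈ m := by
    intro u hu
    by_contra hum
    have := hmax (u :: a :: m) ⟨by
      rw [List.nodup_cons]
      exact ⟨by simpa [hu.ne'] using hum, hn⟩, u, b, by
      simpa using (PathL.single u).append hp hu.symm⟩
    simp at this
  have hdeg : 1 < (G.neighborFinset a).card :=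
    lt_of_lt_of_le (by omega) (h.trans (G.minDegree_le_degree a))
  obtain ⟨u, hu, w, hw, huw⟩ := Finset.one_lt_card.1 hdeg
  simp only [mem_neighborFinset] at hu hw
  cases m with
  | nil => simpa using hin u hu
  | cons x m =>
    have key : ∀ u, G.Adj a u → u ≠ x → ∃ C, CycL G C := by
      intro u hu hux
      obtain ⟨A, B, rfl⟩ := List.append_of_mem (by simpa [hux] using hin u hu : u ∈ m)
      have hp' : PathL G a u ((a :: x :: A) ++ [u]) := PathL.prefix (Y := B) (by simpa using hp)
      refine ⟨_, CycL.mk' hp' hu.symm (List.Nodup.sublist ?_ hn) (by simp)⟩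
      simp
    by_cases hux : u = x
    · exact key w hw (hux ▸ huw.symm)
    · exact key u hu hux

variable [Fintype V] in
theorem vertexConnectivity_le_card {K S : Finset V} (hs : s ∈ K) (hyK : t ∉ K) (hyS : t ∉ S)
    (hKS : ∀ x ∈ K, x ∉ S) (hcl : ∀ x ∈ K, ∀ z, G.Adj x z → z ∈ K ∨ z ∈ S) :
    G.vertexConnectivity ≤ S.card := by
  refine Nat.sInf_le ⟨S, rfl, .inl fun hpre => ?_⟩
  obtain ⟨p⟩ := hpre ⟨s, hKS s hs⟩ ⟨t, hyS⟩
  obtain ⟨d, -, h1, h2⟩ := p.exists_boundary_dart {v | v.1 ∈ K} hs hyK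
  have hadj : G.Adj d.fst.1 d.snd.1 := d.adj
  rcases hcl _ h1 _ hadj with h | h
  · exact h2 h
  · exact d.snd.2 h

theorem vertexConnectivity_le_degree [Fintype V] [DecidableRel G.Adj] (x : V) :
    G.vertexConnectivity ≤ G.degree x := by
  classical
  by_cases h : ∃ y, y ≠ x ∧ ¬ G.Adj x y
  · obtain ⟨y, hy, hxy⟩ := h
    exact vertexConnectivity_le_card (K := {x}) (S := G.neighborFinset x) (s := x) (t := y)
      (by simp) (by simpa using hy) (by simpa using hxy) (by simp) (by simp +contextual)
  · push Not at h
    -- If x is adjacent to everything else, deleting its neighbours disconnects nothing but leaves a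
    -- single vertex.
    refine Nat.sInf_le ⟨G.neighborFinset x, rfl, .inr ?_⟩
    have : (Finset.univ : Finset V) = insert x (G.neighborFinset x) := by
      ext y
      by_cases hy : y = x
      · simp [hy]
      · simp [h y hy]
    rw [← Finset.card_univ, this]
    exact Finset.card_insert_le _ _

theorem cycL_toList {K : Finset V} (hK : ∀ x ∈ K, ∀ y ∈ K, x ≠ y → G.Adj x y)
    (h3 : 3 ≤ K.card) : CycL G K.toList := by
  have hn := K.nodup_toList
  have hl : K.toList.length = K.card := K.length_toList
  have hm : ∀ x ∈ K.toList, x ∈ K := by simp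
  generalize K.toList = l at *
  have hc : l.IsChain G.Adj := (hn.pairwise_of_forall_ne
    fun x hx y hy hxy => hK x (hm x hx) y (hm y hy) hxy).isChain
  cases l with
  | nil => simp at hl; omega
  | cons x l =>
    rcases l.eq_nil_or_concat with rfl | ⟨l, y, rfl⟩
    · simp at hl; omega
    · refine CycL.mk' (a := x) (b := y) ⟨hc, by simp, by simp [List.getLast?_cons]⟩ ?_ hn (by omega)
      exact hK y (hm y (by simp)) x (hm x (by simp)) (by rintro rfl; simp at hn)

variable [DecidableEq V]

theorem Linked.union {K L : Finset V} (hK : Linked G K) (hL : Linked G L) (hc : c ∈ K)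
    (hd : d ∈ L) (hcd : c = d ∨ G.Adj c d) : Linked G (K ∪ L) := by
  have key : ∀ x ∈ K, ∀ y ∈ L, ∃ l, PathL G x y l ∧ ∀ z ∈ l, z ∈ K ∪ L := by
    intro x hx y hy
    obtain ⟨p, hp, hpK⟩ := hK x hx c hc
    obtain ⟨q, hq, hqL⟩ := hL d hd y hy
    have hmem : ∀ z ∈ p ++ q, z ∈ K ∪ L := by
      intro z hz
      rcases List.mem_append.1 hz with h | h
      · exact Finset.mem_union_left _ (hpK z h)
      · exact Finset.mem_union_right _ (hqL z h)
    rcases hcd with rfl | hcd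
    · obtain ⟨q', rfl⟩ := hq.eq_cons
      cases q' with
      | nil =>
        obtain rfl : c = y := by simpa using hq.last
        exact ⟨p, hp, fun z hz => hmem z (by simp [hz])⟩
      | cons e q' =>
        obtain ⟨-, h2, h3⟩ := PathL.split (X := []) hq
        exact ⟨p ++ e :: q', hp.append h2 h3, fun z hz => hmem z (by
          simp only [List.mem_append, List.mem_cons] at hz ⊢; tauto)⟩
    · exact ⟨_, hp.append hq hcd, hmem⟩
  intro x hx y hy
  rcases Finset.mem_union.1 hx with hx | hx <;> rcases Finset.mem_union.1 hy with hy | hy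
  · obtain ⟨l, h1, h2⟩ := hK x hx y hy
    exact ⟨l, h1, fun z hz => Finset.mem_union_left _ (h2 z hz)⟩
  · exact key x hx y hy
  · obtain ⟨l, h1, h2⟩ := key y hy x hx
    exact ⟨l.reverse, h1.reverse, by simpa using h2⟩
  · obtain ⟨l, h1, h2⟩ := hL x hx y hy
    exact ⟨l, h1, fun z hz => Finset.mem_union_right _ (h2 z hz)⟩

theorem CycL.adj_formPerm (h : CycL G C) (hs : s ∈ C) : G.Adj s (C.formPerm s) := by
  obtain ⟨_, _, _, h⟩ := h.exists_rotation hs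
  exact h

theorem CycL.formPerm_formPerm_ne (h : CycL G C) (hs : s ∈ C) :
    C.formPerm (C.formPerm s) ≠ s := by
  obtain ⟨L, hL, hp, -⟩ := h.exists_rotation hs
  obtain ⟨m, rfl⟩ := hp.eq_cons
  have hlen := h.three_le
  rw [← hL.perm.length_eq] at hlen
  have hn := hL.perm.nodup_iff.2 h.nodup
  rcases m with _ | ⟨x, m⟩
  · simp at hlen
  · rw [formPerm_eq_of_consecutive (X := []) h.nodup hL]
    rintro rfl
    rcases m.eq_nil_or_concat with rfl | ⟨m, y, rfl⟩
    · simp at hlen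
    · have := hp.last
      simp [List.getLast?_cons] at this
      simp [this] at hn

/-- The edges join x to τ x, where τ is the successor map of both cycles. The degree is 2 because τ²
has no fixed point, and the components are the two orbits of τ. -/
theorem exists_isTwoFactor_of_cycL (h1 : CycL G A) (h2 : CycL G B) (hn : (A ++ B).Nodup)
    (hcov : ∀ v, v ∈ A ++ B) :
    ∃ H : SimpleGraph V, G.IsTwoFactor H ∧ Nat.card H.ConnectedComponent = 2 := by
  have hdis : ∀ x ∈ A, x ∉ B := fun x hA hB => (List.nodup_append.1 hn).2.2 x hA x hB rfl
  set τ : Equiv.Perm V := A.formPerm * B.formPerm with hτ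
  have τA : ∀ x ∈ A, τ x = A.formPerm x := fun x hx => by
    rw [hτ, Equiv.Perm.mul_apply, List.formPerm_apply_of_notMem (hdis x hx)]
  have τB : ∀ x ∈ B, τ x = B.formPerm x := fun x hx => by
    rw [hτ, Equiv.Perm.mul_apply, List.formPerm_apply_of_notMem]
    exact fun h => hdis _ h (CycL.formPerm_mem hx)
  have τmem : ∀ x, τ x ∈ A ↔ x ∈ A := by
    intro x
    rcases List.mem_append.1 (hcov x) with hx | hx
    · simp [τA x hx, hx]
    · rw [τB x hx]
      exact ⟨fun h => absurd (CycL.formPerm_mem hx) (hdis _ h), fun h => absurd hx (hdis _ h)⟩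
  have τadj : ∀ x, G.Adj x (τ x) := by
    intro x
    rcases List.mem_append.1 (hcov x) with hx | hx
    · rw [τA x hx]; exact h1.adj_formPerm hx
    · rw [τB x hx]; exact h2.adj_formPerm hx
  have ττ : ∀ x, τ (τ x) ≠ x := by
    intro x
    rcases List.mem_append.1 (hcov x) with hx | hx
    · rw [τA x hx, τA _ (CycL.formPerm_mem hx)]; exact h1.formPerm_formPerm_ne hx
    · rw [τB x hx, τB _ (CycL.formPerm_mem hx)]; exact h2.formPerm_formPerm_ne hx
  let H : SimpleGraph V :=
    { Adj := fun x y => τ x = y ∨ τ y = x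
      symm := ⟨fun x y h => h.symm⟩
      loopless := ⟨fun x h => (τadj x).ne (by simpa [eq_comm] using h)⟩ }
  have Hadj : ∀ x, H.Adj x (τ x) := fun x => Or.inl rfl
  have Hpow : ∀ x (n : ℕ), H.Reachable x ((τ ^ n) x) := by
    intro x n
    induction n with
    | zero => simp
    | succ n ih =>
      rw [pow_succ', Equiv.Perm.mul_apply]
      exact ih.trans (Hadj _).reachable
  have hreach : ∀ {D : List V}, CycL G D → (∀ x ∈ D, τ x = D.formPerm x) →
      ∀ x ∈ D, ∀ y ∈ D, H.Reachable x y := by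
    intro D hD hτD x hx y hy
    have hc := hD.nodup.isCycleOn_formPerm
    have hc' : D.formPerm.IsCycleOn (D.toFinset : Set V) := by simpa using hc
    obtain ⟨n, -, rfl⟩ := hc'.exists_pow_eq (a := x) (b := y) (by simpa using hx) (by simpa using hy)
    have : ∀ n : ℕ, (τ ^ n) x = (D.formPerm ^ n) x ∧ (D.formPerm ^ n) x ∈ D := by
      intro n
      induction n with
      | zero => simpa using hx
      | succ n ih =>
        simp only [pow_succ', Equiv.Perm.mul_apply (f := τ), Equiv.Perm.mul_apply (f := D.formPerm),
          ih.1, hτD _ ih.2]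
        exact ⟨trivial, CycL.formPerm_mem ih.2⟩
    rw [← (this n).1]
    exact Hpow x n
  have hinv : ∀ x y, H.Reachable x y → (x ∈ A ↔ y ∈ A) := by
    rintro x y ⟨p⟩
    induction p with
    | nil => rfl
    | cons h p ih =>
      rw [← ih]
      rcases h with rfl | rfl
      · exact (τmem _).symm
      · exact τmem _
  refine ⟨H, ⟨?_, ?_⟩, ?_⟩
  · rintro x y (rfl | rfl)
    · exact τadj x
    · exact (τadj y).symm
  · intro x
    have : H.neighborSet x = {τ x, τ.symm x} := by
      ext y
      simp only [mem_neighborSet, Set.mem_insert_iff, Set.mem_singleton_iff]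
      change (τ x = y ∨ τ y = x) ↔ _
      rw [Equiv.eq_symm_apply, eq_comm (a := y)]
    rw [this, Set.ncard_pair]
    intro h
    rw [Equiv.eq_symm_apply] at h
    exact ττ x h
  · obtain ⟨a, _, ha, -⟩ := h1.closed
    obtain ⟨b, _, hb, -⟩ := h2.closed
    rw [Nat.card_eq_two_iff]
    refine ⟨H.connectedComponentMk a, H.connectedComponentMk b, ?_, ?_⟩
    · rw [Ne, ConnectedComponent.eq]
      intro h
      exact hdis b ((hinv _ _ h).1 ha.head_mem) hb.head_mem
    · ext x
      induction x using ConnectedComponent.ind with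
      | _ x =>
        simp only [Set.mem_insert_iff, Set.mem_singleton_iff, ConnectedComponent.eq, Set.mem_univ,
          iff_true]
        rcases List.mem_append.1 (hcov x) with hx | hx
        · exact .inl (hreach h1 τA _ hx _ ha.head_mem)
        · exact .inr (hreach h2 τB _ hx _ hb.head_mem)

end SimpleGraph

/-! ### Chvátal–Erdős rerouting on a longest cycle. -/

namespace SimpleGraph

variable {V : Type*} {G : SimpleGraph V} {a b c d s t u v h : V} {A B C X Y : List V}
  {K I : Finset V}

theorem Linked.exists_ear (hK : Linked G K) (hs : ∃ x ∈ K, G.Adj s x) (ht : ∃ x ∈ K, G.Adj t x) :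
    ∃ P p q, PathL G p q P ∧ P.Nodup ∧ (∀ z ∈ P, z ∈ K) ∧ G.Adj s p ∧ G.Adj q t := by
  obtain ⟨p, hp, hsp⟩ := hs
  obtain ⟨q, hq, htq⟩ := ht
  obtain ⟨P, h1, h2, h3⟩ := hK.exists_nodup hp hq
  exact ⟨P, p, q, h1, h2, h3, hsp, htq.symm⟩

theorem IsIndepSet.insert_of_forall [DecidableEq V] (hI : G.IsIndepSet I)
    (hv : ∀ u ∈ I, ¬ G.Adj v u) : G.IsIndepSet (insert v I : Finset V) := by
  have : Std.Symm fun v w => ¬ G.Adj v w := ⟨fun x y h h' => h h'.symm⟩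
  rw [Finset.coe_insert, IsIndepSet, Set.pairwise_insert_of_symm]
  exact ⟨hI, fun u hu _ => hv u hu⟩

theorem exists_adj_of_indepNum_le [Fintype V] {k : ℕ} (hα : G.indepNum ≤ k) (hI : G.IsIndepSet I)
    (hk : k ≤ I.card) (hv : v ∉ I) : ∃ u ∈ I, G.Adj v u := by
  classical
  by_contra! hno
  have := (hI.insert_of_forall hno).card_le_indepNum
  rw [Finset.card_insert_of_notMem hv] at this
  omega

theorem IsIndepSet.exchange [DecidableEq V] (hI : G.IsIndepSet I)
    (hx : ∀ u ∈ I, u ≠ a → ¬ G.Adj b u) :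
    G.IsIndepSet (insert b (I.erase a) : Finset V) := by
  refine IsIndepSet.insert_of_forall (hI.mono (by simp)) fun u hu => ?_
  rw [Finset.mem_erase] at hu
  exact hx u hu.2 hu.1

theorem nodup_append_of_forall_mem (hC : C.Nodup) (hX : X.Nodup) (hXK : ∀ x ∈ X, x ∈ K)
    (hKC : ∀ x ∈ K, x ∉ C) : (C ++ X).Nodup :=
  List.nodup_append.2 ⟨hC, hX, fun _ hx y hy hxy => hKC y (hXK y hy) (hxy ▸ hx)⟩

variable [DecidableEq V]

theorem card_exchange (ha : a ∈ I) (hb : b ∉ I) : (insert b (I.erase a)).card = I.card := by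
  rw [Finset.card_insert_of_notMem (by simp [hb]), Finset.card_erase_add_one ha]

open Classical in
/-- The vertices of `C` with a neighbour in `K`. -/
noncomputable def attach (G : SimpleGraph V) (C : List V) (K : Finset V) : Finset V :=
  {s ∈ C.toFinset | ∃ x ∈ K, G.Adj s x}

theorem mem_attach : s ∈ attach G C K ↔ s ∈ C ∧ ∃ x ∈ K, G.Adj s x := by
  simp [attach]

/-- `C` is a longest cycle of `G` and `K` is a linked set of vertices off `C`. -/
structure OffLongest (G : SimpleGraph V) (C : List V) (K : Finset V) : Prop where
  cyc : CycL G C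
  max : ∀ C', CycL G C' → C'.length ≤ C.length
  linked : Linked G K
  notMem : ∀ x ∈ K, x ∉ C

namespace OffLongest

/-- Otherwise an ear through K could replace the edge from s to s⁺, lengthening C. -/
theorem formPerm_notMem_attach (hO : OffLongest G C K) (hs : s ∈ attach G C K) :
    C.formPerm s ∉ attach G C K := by
  intro hs'
  rw [mem_attach] at hs hs'
  obtain ⟨P, p, q, hP, hPn, hPK, hsp, hq⟩ := hO.linked.exists_ear hs.2 hs'.2
  obtain ⟨L, hL, hLp, -⟩ := hO.cyc.exists_rotation hs.1
  have hLn := hL.perm.nodup_iff.2 hO.cyc.nodup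
  have hcyc : CycL G (L ++ P) := by
    refine CycL.mk' (hLp.append hP hsp) hq (nodup_append_of_forall_mem hLn hPn hPK ?_) ?_
    · simpa [hL.perm.mem_iff] using hO.notMem
    · have := hO.cyc.three_le
      simp [hL.perm.length_eq]; omega
  have h1 := hO.max _ hcyc
  have h2 := List.length_pos_iff.2 hP.ne_nil
  rw [List.length_append, hL.perm.length_eq] at h1
  omega

/-- With an ear P from s to t, the edge s⁺t⁺ would close the longer cycle t⁺…s P t…s⁺. -/
theorem not_adj_formPerm (hO : OffLongest G C K) (hs : s ∈ attach G C K)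
    (ht : t ∈ attach G C K) (hne : s ≠ t) :
    ¬ G.Adj (C.formPerm s) (C.formPerm t) := by
  intro hadj
  rw [mem_attach] at hs ht
  obtain ⟨P, p, q, hP, hPn, hPK, hsp, hq⟩ := hO.linked.exists_ear hs.2 ht.2
  obtain ⟨A, B, hAB, hA, hB⟩ := hO.cyc.exists_split hs.1 ht.1 hne
  have hn := nodup_append_of_forall_mem (hAB.perm.nodup_iff.2 hO.cyc.nodup) hPn hPK
    (by simpa only [hAB.perm.mem_iff] using hO.notMem)
  have hp : (A ++ B ++ P).Perm (B ++ P ++ A.reverse) :=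
    List.perm_iff_count.2 fun x => by simp only [List.count_append, List.count_reverse]; omega
  have hlen := hAB.perm.length_eq
  have h2 := List.length_pos_iff.2 hP.ne_nil
  have h3 := hO.cyc.three_le
  have h1 := hO.max _ (CycL.mk' ((hB.append hP hsp).append hA.reverse hq) hadj
    (hp.nodup_iff.1 hn) (by simp at hlen ⊢; omega))
  simp at h1 hlen
  omega

theorem isIndepSet_insert_image (hO : OffLongest G C K) (hh : h ∈ K) :
    G.IsIndepSet (insert h ((attach G C K).image C.formPerm) : Finset V) := by
  refine IsIndepSet.insert_of_forall ?_ ?_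
  · intro x hx y hy hxy
    simp only [Finset.coe_image, Set.mem_image, Finset.mem_coe] at hx hy
    obtain ⟨s, hs, rfl⟩ := hx
    obtain ⟨t, ht, rfl⟩ := hy
    exact hO.not_adj_formPerm hs ht (by rintro rfl; exact hxy rfl)
  · intro x hx hadj
    simp only [Finset.mem_image] at hx
    obtain ⟨s, hs, rfl⟩ := hx
    refine hO.formPerm_notMem_attach hs (mem_attach.2 ⟨?_, h, hh, hadj.symm⟩)
    exact CycL.formPerm_mem (mem_attach.1 hs).1

/-- S is a cut: it contains no two consecutive vertices, so some vertex of C lies outside it. -/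
theorem vertexConnectivity_le_card_attach (hO : OffLongest G C K) [Fintype V] (hh : h ∈ K)
    (hcl : ∀ x ∈ K, ∀ y, G.Adj x y → y ∈ K ∨ y ∈ C) :
    G.vertexConnectivity ≤ (attach G C K).card := by
  obtain ⟨y, hyC, hy⟩ : ∃ y ∈ C, y ∉ attach G C K := by
    obtain ⟨x, hx⟩ := List.exists_mem_of_ne_nil C (by
      rintro rfl; simpa using hO.cyc.three_le)
    by_cases hxS : x ∈ attach G C K
    · exact ⟨_, CycL.formPerm_mem hx, hO.formPerm_notMem_attach hxS⟩
    · exact ⟨x, hx, hxS⟩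
  refine vertexConnectivity_le_card hh (fun hyK => hO.notMem y hyK hyC) hy
    (fun x hx hxS => hO.notMem x hx (mem_attach.1 hxS).1) fun x hx z hxz => ?_
  rcases hcl x hx z hxz with hz | hz
  · exact .inl hz
  · exact .inr (mem_attach.2 ⟨hz, x, hx, hxz.symm⟩)

theorem card_insert_image (hO : OffLongest G C K) (hh : h ∈ K) :
    (insert h ((attach G C K).image C.formPerm)).card = (attach G C K).card + 1 := by
  rw [Finset.card_insert_of_notMem, Finset.card_image_of_injective _ C.formPerm.injective]
  simp only [Finset.mem_image, not_exists, not_and]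
  rintro s hs rfl
  exact hO.notMem _ hh (CycL.formPerm_mem (mem_attach.1 hs).1)

end OffLongest

end SimpleGraph

/-! ### The maximal set K contains every vertex off C. -/

namespace SimpleGraph

variable {V : Type*} {G : SimpleGraph V} {a b c d s t u v h x y : V} {A B C X Y : List V}
  {H K I : Finset V} [DecidableEq V]

namespace OffLongest

theorem union (hK : OffLongest G C K) (hH : OffLongest G C H) (hx : x ∈ K) (hy : y ∈ H)
    (hxy : x = y ∨ G.Adj x y) : OffLongest G C (K ∪ H) where
  cyc := hK.cyc
  max := hK.max
  linked := hK.linked.union hH.linked hx hy hxy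
  notMem z hz := (Finset.mem_union.1 hz).elim (hK.notMem z) (hH.notMem z)

theorem extend (hK : OffLongest G C K) (hx : x ∈ K) (hxy : G.Adj x y) (hy : y ∉ C) :
    OffLongest G C (K ∪ {y}) :=
  hK.union ⟨hK.cyc, hK.max, linked_singleton y, by simpa using hy⟩ hx
    (Finset.mem_singleton_self y) (.inr hxy)

theorem card_union_singleton (hy : y ∉ K) : (K ∪ {y}).card = K.card + 1 := by
  rw [Finset.union_comm, ← Finset.insert_eq, Finset.card_insert_of_notMem hy]

theorem closed (hK : OffLongest G C K)
    (hm : ∀ y, OffLongest G C (K ∪ {y}) → (K ∪ {y}).card ≤ K.card)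
    (hx : x ∈ K) (hxy : G.Adj x y) : y ∈ K ∨ y ∈ C := by
  by_contra! hy
  have := hm y (hK.extend hx hxy hy.2)
  rw [card_union_singleton hy.1] at this
  omega

/-- The path s⁺ x t⁺ plays the role of the edge s⁺t⁺ in `not_adj_formPerm`. -/
theorem not_adj_formPerm_of_adj (hH : OffLongest G C H) (hs : s ∈ attach G C H)
    (ht : t ∈ attach G C H) (hst : s ≠ t) (hxC : x ∉ C) (hxH : x ∉ H)
    (hxs : G.Adj x (C.formPerm s)) : ¬ G.Adj x (C.formPerm t) := by
  intro hxt
  rw [mem_attach] at hs ht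
  obtain ⟨P, p, q, hP, hPn, hPH, hsp, hq⟩ := hH.linked.exists_ear hs.2 ht.2
  obtain ⟨A, B, hAB, hA, hB⟩ := hH.cyc.exists_split hs.1 ht.1 hst
  have hn : (A ++ B ++ P ++ [x]).Nodup := by
    have := nodup_append_of_forall_mem (hAB.perm.nodup_iff.2 hH.cyc.nodup) hPn hPH
      (by simpa only [hAB.perm.mem_iff] using hH.notMem)
    refine nodup_append_of_forall_mem (K := {x}) this (by simp) (by simp) ?_
    simp only [Finset.mem_singleton, forall_eq]
    rw [List.mem_append, hAB.perm.mem_iff]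
    rintro (h | h)
    · exact hxC h
    · exact hxH (hPH x h)
  have hp : (A ++ B ++ P ++ [x]).Perm (B ++ P ++ A.reverse ++ [x]) :=
    List.perm_iff_count.2 fun x => by simp only [List.count_append, List.count_reverse]; omega
  have hlen := hAB.perm.length_eq
  have h3 := hH.cyc.three_le
  have h1 := hH.max _ (CycL.mk' (((hB.append hP hsp).append hA.reverse hq).append (.single x)
    hxs.symm) hxt (hp.nodup_iff.1 hn) (by simp at hlen ⊢; omega))
  simp at h1 hlen
  omega

/-- A vertex v missed by both lies in another component H of G − C. Some x in K is then adjacent to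
f = t⁺ with t in `attach G C H`, and C can be rerouted through H to skip f without getting shorter.
This frees f to enlarge K. -/
theorem covers [Fintype V] (hK : OffLongest G C K) (hx : x ∈ K)
    (hm : ∀ C' K', OffLongest G C' K' → K'.card ≤ K.card)
    (hα : G.indepNum ≤ G.vertexConnectivity + 1) (v : V) : v ∈ C ∨ v ∈ K := by
  by_contra! hv
  obtain ⟨H, ⟨hvH, hH⟩, hHm⟩ := exists_maximal_of_le
    (P := fun H => v ∈ H ∧ OffLongest G C H) (f := Finset.card) (N := Fintype.card V)
    (fun H _ => H.card_le_univ)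
    ⟨{v}, by simp, hK.cyc, hK.max, linked_singleton v, by simpa using hv.1⟩
  have hKcl : ∀ x ∈ K, ∀ y, G.Adj x y → y ∈ K ∨ y ∈ C := fun x hx y hxy =>
    hK.closed (fun y h => hm _ _ h) hx hxy
  have hHcl : ∀ x ∈ H, ∀ y, G.Adj x y → y ∈ H ∨ y ∈ C := fun x hx y hxy =>
    hH.closed (fun y h => hHm _ ⟨Finset.mem_union_left _ hvH, h⟩) hx hxy
  have hdis : ∀ z ∈ K, z ∉ H := by
    intro z hzK hzH
    have h1 := hm _ _ (hK.union hH hzK hzH (.inl rfl))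
    have h2 : K = K ∪ H := Finset.eq_of_subset_of_card_le Finset.subset_union_left h1
    exact hv.2 (h2 ▸ Finset.mem_union_right _ hvH)
  have hxv : ¬ G.Adj x v := fun h => (hKcl x hx v h).elim hv.2 hv.1
  have hxC := hK.notMem x hx
  have hI := hH.isIndepSet_insert_image hvH
  have hIc := hH.card_insert_image hvH
  have hκ := hH.vertexConnectivity_le_card_attach hvH hHcl
  have hCim : ∀ z ∈ (attach G C H).image C.formPerm, z ∈ C := by
    intro z hz
    obtain ⟨s, hs, rfl⟩ := Finset.mem_image.1 hz
    exact CycL.formPerm_mem (mem_attach.1 hs).1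
  have hxI : x ∉ insert v ((attach G C H).image C.formPerm) := by
    rw [Finset.mem_insert]
    rintro (rfl | h)
    · exact hdis x hx hvH
    · exact hxC (hCim x h)
  obtain ⟨u, hu, hxu⟩ := exists_adj_of_indepNum_le hα hI (by omega) hxI
  rw [Finset.mem_insert] at hu
  obtain ⟨t, ht, rfl⟩ : ∃ t ∈ attach G C H, C.formPerm t = u := by
    rcases hu with rfl | hu
    · exact absurd hxu hxv
    · exact Finset.mem_image.1 hu
  have htm := mem_attach.1 ht
  set f := C.formPerm t with hf
  have hfS : f ∉ attach G C H := hH.formPerm_notMem_attach ht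
  have hfC : f ∈ C := CycL.formPerm_mem htm.1
  have finish : ∀ C', CycL G C' → C.length ≤ C'.length → f ∉ C' → (∀ z ∈ C', z ∈ C ∨ z ∈ H) →
      False := by
    intro C' h1 h2 h3 h4
    have hKf : f ∉ K := fun h => hK.notMem f h hfC
    have : OffLongest G C' (K ∪ {f}) := by
      refine ⟨h1, fun D hD => (hK.max D hD).trans h2,
        hK.linked.union (linked_singleton f) hx (Finset.mem_singleton_self f) (.inr hxu), ?_⟩
      intro z hz
      rcases Finset.mem_union.1 hz with hz | hz
      · exact fun hzC => (h4 z hzC).elim (hK.notMem z hz) (hdis z hz)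
      · rw [Finset.mem_singleton.1 hz]; exact h3
    have := hm _ _ this
    rw [card_union_singleton hKf] at this
    omega
  -- f is the only neighbour of x in the maximum independent set, so x may replace it; f⁺ must then
  -- have a neighbour u in the new set.
  have hI' := hI.exchange (a := f) (b := x) (by
    intro u hu huf hxu'
    rcases Finset.mem_insert.1 hu with rfl | hu
    · exact hxv hxu'
    · obtain ⟨t', ht', rfl⟩ := Finset.mem_image.1 hu
      refine hH.not_adj_formPerm_of_adj ht ht' ?_ hxC (hdis x hx) hxu hxu'
      rintro rfl; exact huf rfl)
  have hIc' := card_exchange (I := insert v ((attach G C H).image C.formPerm)) (a := f) (b := x)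
    (by simp only [Finset.mem_insert, Finset.mem_image]; exact .inr ⟨t, ht, rfl⟩) hxI
  have hffC : C.formPerm f ∈ C := CycL.formPerm_mem hfC
  obtain ⟨u, hu, hfu⟩ := exists_adj_of_indepNum_le hα hI' (by omega) (v := C.formPerm f) (by
    simp only [Finset.mem_insert, Finset.mem_erase, Finset.mem_image, not_or, not_and]
    refine ⟨fun h => hxC (h ▸ hffC), fun _ => ⟨fun h => hv.1 (h ▸ hffC), ?_⟩⟩
    rintro ⟨s, hs, hsf⟩
    exact hfS (C.formPerm.injective hsf ▸ hs))
  simp only [Finset.mem_insert, Finset.mem_erase, Finset.mem_image] at hu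
  rcases hu with rfl | ⟨huf, rfl | ⟨d, hd, rfl⟩⟩
  · exact hK.formPerm_notMem_attach (mem_attach.2 ⟨hfC, u, hx, hxu.symm⟩)
      (mem_attach.2 ⟨hffC, u, hx, hfu⟩)
  -- Here u = v, so f⁺ attaches to H and f⁺…t P is a cycle skipping f.
  · obtain ⟨P, p, q, hP, hPn, hPH, htp, hq⟩ := hH.linked.exists_ear htm.2 ⟨u, hvH, hfu⟩
    obtain ⟨L, hL, hLp, -⟩ := hH.cyc.exists_rotation htm.1
    obtain ⟨L, rfl⟩ := hLp.eq_cons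
    have h3 := hH.cyc.three_le
    have hlen := hL.perm.length_eq
    cases L with
    | nil => simp at hlen; omega
    | cons c L =>
      obtain ⟨-, hc, -⟩ := PathL.split (X := []) hLp
      obtain rfl : C.formPerm f = c := formPerm_eq_of_consecutive (X := []) hH.cyc.nodup hL
      have hn := nodup_append_of_forall_mem (hL.perm.nodup_iff.2 hH.cyc.nodup) hPn hPH
        (by simpa only [hL.perm.mem_iff] using hH.notMem)
      have hPl := List.length_pos_iff.2 hP.ne_nil
      rw [List.cons_append, List.nodup_cons] at hn
      simp only [List.length_cons] at hlen
      have hl : C.length ≤ (C.formPerm f :: L ++ P).length := by simp; omega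
      refine finish _ (CycL.mk' (hc.append hP htp) hq hn.2 (by omega)) hl hn.1 fun z hz => ?_
      rcases List.mem_append.1 hz with hz | hz
      · exact .inl (hL.perm.mem_iff.1 (List.mem_cons_of_mem _ hz))
      · exact .inr (hPH z hz)
  -- Here u = d⁺, and the cycle skipping f is f⁺…d P t…d⁺.
  · have hdt : t ≠ d := by rintro rfl; exact huf rfl
    have hdm := mem_attach.1 hd
    obtain ⟨P, p, q, hP, hPn, hPH, hdp, hq⟩ := hH.linked.exists_ear hdm.2 htm.2
    obtain ⟨A, B, hAB, hA, hB⟩ := hH.cyc.exists_split htm.1 hdm.1 hdt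
    obtain ⟨A, rfl⟩ := hA.eq_cons
    cases A with
    | nil =>
      have : f = d := by simpa using hA.last
      exact hfS (this ▸ hd)
    | cons c A =>
      obtain ⟨-, hc, -⟩ := PathL.split (X := []) hA
      obtain rfl : C.formPerm f = c :=
        formPerm_eq_of_consecutive (X := []) (Y := A ++ B) hH.cyc.nodup (by simpa using hAB)
      have hn := nodup_append_of_forall_mem (hAB.perm.nodup_iff.2 hH.cyc.nodup) hPn hPH
        (by simpa only [hAB.perm.mem_iff] using hH.notMem)
      have hPl := List.length_pos_iff.2 hP.ne_nil
      have hlen := hAB.perm.length_eq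
      have h3 := hH.cyc.three_le
      have hp : (C.formPerm f :: A ++ B ++ P).Perm (C.formPerm f :: A ++ P ++ B.reverse) :=
        List.perm_iff_count.2 fun x => by
          simp only [List.count_append, List.count_reverse]; omega
      rw [List.cons_append, List.cons_append, List.nodup_cons, hp.mem_iff, hp.nodup_iff] at hn
      simp only [List.length_cons, List.length_append] at hlen
      have hl : C.length ≤ (C.formPerm f :: A ++ P ++ B.reverse).length := by simp; omega
      refine finish _ (CycL.mk' ((hc.append hP hdp).append hB.reverse hq) hfu.symm hn.2 (by omega))
        hl hn.1 fun z hz => ?_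
      rw [← hp.mem_iff, List.mem_append] at hz
      rcases hz with hz | hz
      · refine .inl (hAB.perm.mem_iff.1 ?_)
        rw [List.cons_append]
        exact List.mem_cons_of_mem _ hz
      · exact .inr (hPH z hz)

end OffLongest

end SimpleGraph

/-! ### A long segment of C avoiding S. -/

namespace SimpleGraph

variable {V : Type*} {G : SimpleGraph V} {a b c d s s' t u v x y z : V} {A B C T W X Y : List V}
  {K I : Finset V}

theorem exists_split_first {α : Type*} (p : α → Prop) (l : List α) (hl : ∃ x ∈ l, ¬ p x) :
    ∃ X w Y, l = X ++ w :: Y ∧ (∀ x ∈ X, p x) ∧ ¬ p w := by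
  induction l with
  | nil => simp at hl
  | cons x l ih =>
    by_cases hx : p x
    · obtain ⟨X, w, Y, rfl, h1, h2⟩ := ih (by simpa [hx] using hl)
      exact ⟨x :: X, w, Y, by simp, by simpa [hx] using h1, h2⟩
    · exact ⟨[], x, l, by simp, by simp, hx⟩

variable [DecidableEq V]

namespace OffLongest

theorem exists_segment (hO : OffLongest G C K) (hne : (attach G C K).Nonempty)
    (hlt : 3 * (attach G C K).card < C.length) :
    ∃ T W a z s' s, (T ++ W) ~r C ∧ PathL G a z T ∧ PathL G s' s W ∧ G.Adj z s' ∧ G.Adj s a ∧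
      s ∈ attach G C K ∧ s' ∈ attach G C K ∧ (∀ x ∈ T, x ∉ attach G C K) ∧ 3 ≤ T.length := by
  classical
  obtain ⟨e, he⟩ := hne
  obtain ⟨L, hL, hLp, -⟩ := hO.cyc.exists_rotation (mem_attach.1 he).1
  have hLn := hL.perm.nodup_iff.2 hO.cyc.nodup
  have hcount : L.countP (· ∈ attach G C K) ≤ (attach G C K).card := by
    rw [List.countP_eq_length_filter, ← List.toFinset_card_of_nodup (hLn.filter _)]
    refine Finset.card_le_card fun v hv => ?_
    rw [List.mem_toFinset, List.mem_filter] at hv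
    simpa using hv.2
  obtain ⟨X, T, s', Y, rfl, hT, hs', h3, hX⟩ := exists_long_gap (· ∈ attach G C K) L
    (by rw [hLp.last]; simpa using he) (by rw [hL.perm.length_eq]; omega)
  have hrot : (T ++ (s' :: Y ++ X)) ~r C := by
    refine List.IsRotated.trans ?_ hL
    simpa using List.isRotated_append (l := T ++ s' :: Y) (l' := X)
  obtain ⟨a, s, hp, hsa⟩ := (hO.cyc.rotated hrot).closed
  have hs : s ∈ attach G C K := by
    have hlast := hp.last
    rcases X.eq_nil_or_concat with rfl | ⟨X, w, rfl⟩
    · have h1 := hLp.last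
      simp only [List.nil_append, List.append_nil] at h1 hlast
      rw [h1] at hlast
      exact Option.some_injective _ hlast ▸ he
    · have : w = s := by
        rw [List.getLast?_append] at hlast
        simpa [List.getLast?_cons] using hlast
      exact this ▸ hX w (by simp)
  rcases T.eq_nil_or_concat with rfl | ⟨T, z, rfl⟩
  · simp at h3
  · obtain ⟨h1, h2, h4⟩ := PathL.split (X := T) (u := z) (c := s') (Y := Y ++ X) (by simpa using hp)
    exact ⟨_, _, a, z, s', s, hrot, by simpa using h1, h2, h4, hsa, hs, hs', hT, h3⟩

/-- If z is not adjacent to a, either z ~ t⁺ for some t ≠ s' in S, which splits the graph into two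
cycles, or s'⁺ is the only neighbour of z in {x} ∪ S⁺. In the second case z can replace s'⁺, and the
first vertex w after s' that is in S or not adjacent to z yields a cycle longer than C. -/
theorem ends_adj_or_exists_isTwoFactor [Fintype V] (hO : OffLongest G C K) (hx : x ∈ K)
    (hcov : ∀ v, v ∈ C ∨ v ∈ K) (hα : G.indepNum ≤ (attach G C K).card + 1)
    (hear : ∀ s ∈ attach G C K, ∀ t ∈ attach G C K, s ≠ t → ∃ P p q, PathL G p q P ∧ P.Nodup ∧
      (∀ z, z ∈ P ↔ z ∈ K) ∧ G.Adj s p ∧ G.Adj q t)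
    (hTW : (T ++ W) ~r C) (hT : PathL G a z T) (hW : PathL G s' s W) (hzs : G.Adj z s')
    (hsa : G.Adj s a) (hs : s ∈ attach G C K) (hs' : s' ∈ attach G C K)
    (hTS : ∀ x ∈ T, x ∉ attach G C K) (h3 : 3 ≤ T.length) :
    G.Adj z a ∨
      ∃ H : SimpleGraph V, G.IsTwoFactor H ∧ Nat.card H.ConnectedComponent = 2 := by
  by_contra! hcon
  obtain ⟨hza, hno⟩ := hcon
  replace hno : ¬ ∃ H : SimpleGraph V, G.IsTwoFactor H ∧ Nat.card H.ConnectedComponent = 2 :=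
    fun ⟨H, h1, h2⟩ => hno H h1 h2
  have hCn := hO.cyc.nodup
  have hTWn := hTW.perm.nodup_iff.2 hCn
  have hmemC : ∀ v, v ∈ C ↔ v ∈ T ∨ v ∈ W := fun v => by
    rw [← hTW.perm.mem_iff, List.mem_append]
  have hKTW : ∀ x ∈ K, x ∉ T ++ W := by simpa only [hTW.perm.mem_iff] using hO.notMem
  have hσs : C.formPerm s = a := (hT.append hW hzs).formPerm_last hCn hTW
  have hIc := hO.card_insert_image hx
  have hI := hO.isIndepSet_insert_image hx
  set S := attach G C K with hS
  have hSW : ∀ t ∈ S, t ∈ W := fun t ht =>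
    ((hmemC t).1 (mem_attach.1 ht).1).resolve_left fun h => hTS t h ht
  have hzT := hT.last_mem
  have hzC : z ∈ C := (hmemC z).2 (.inl hzT)
  have hzx : z ≠ x := fun h => hO.notMem x hx (h ▸ hzC)
  have hσz : ∀ t ∈ S, C.formPerm t ≠ z := by
    intro t ht htz
    obtain ⟨T', rfl⟩ := hT.eq_concat
    rcases T'.eq_nil_or_concat with rfl | ⟨T', y, rfl⟩
    · simp at h3
    · have hy : C.formPerm y = z :=
        formPerm_eq_of_consecutive (X := T') (Y := W) hCn (by simpa using hTW)
      obtain rfl : t = y := C.formPerm.injective (htz.trans hy.symm)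
      exact hTS t (by simp) ht
  have hzI : z ∉ insert x (S.image C.formPerm) := by
    simp only [Finset.mem_insert, Finset.mem_image, not_or, not_exists, not_and]
    exact ⟨hzx, hσz⟩
  have hzxa : ∀ y ∈ K, ¬ G.Adj z y := fun y hy h => hTS z hzT (mem_attach.2 ⟨hzC, y, hy, h⟩)
  -- Otherwise the two cycles are t⁺…s a…z and s'…t P, with P an ear through all of K.
  have only : ∀ t ∈ S, G.Adj z (C.formPerm t) → t = s' := by
    intro t ht hzt
    by_contra hts'
    have hts : t ≠ s := by rintro rfl; exact hza (hσs ▸ hzt)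
    obtain ⟨P, p, q, hP, hPn, hPK, htp, hq⟩ := hear t ht s' hs' hts'
    obtain ⟨W₁, c, W₂, rfl⟩ := hW.exists_split (hSW t ht) hts
    obtain ⟨hW₁, hW₂, -⟩ := hW.split
    have hc : C.formPerm t = c :=
      formPerm_eq_of_consecutive (X := T ++ W₁) hCn (by simpa using hTW)
    have hn := nodup_append_of_forall_mem hTWn hPn (fun z hz => (hPK z).1 hz) hKTW
    have hp : (T ++ (W₁ ++ t :: c :: W₂) ++ P).Perm ((c :: W₂ ++ T) ++ (W₁ ++ [t] ++ P)) := by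
      rw [show W₁ ++ t :: c :: W₂ = W₁ ++ [t] ++ c :: W₂ by simp]
      exact List.perm_iff_count.2 fun x => by simp only [List.count_append]; omega
    have hn' := hp.nodup_iff.1 hn
    have hPl := List.length_pos_iff.2 hP.ne_nil
    have hW₁l : W₁ ≠ [] := by
      rintro rfl
      exact hts' (by simpa using hW₁.head)
    have hW₁l' := List.length_pos_iff.2 hW₁l
    refine hno (exists_isTwoFactor_of_cycL
      (CycL.mk' (hW₂.append hT hsa) (hc ▸ hzt) (List.nodup_append.1 hn').1 ?_)
      (CycL.mk' (hW₁.append hP htp) hq (List.nodup_append.1 hn').2.1 ?_) hn' ?_)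
    · simp; omega
    · simp; omega
    · intro v
      rw [← hp.mem_iff, List.mem_append, hTW.perm.mem_iff, hPK]
      exact hcov v
  obtain ⟨u, hu, hzu⟩ := exists_adj_of_indepNum_le hα hI (by omega) hzI
  have hzs' : G.Adj z (C.formPerm s') := by
    rcases Finset.mem_insert.1 hu with rfl | hu
    · exact absurd hzu (hzxa u hx)
    · obtain ⟨t, ht, rfl⟩ := Finset.mem_image.1 hu
      exact only t ht hzu ▸ hzu
  have hss' : s' ≠ s := by rintro rfl; exact hza (hσs ▸ hzs')
  have long : ∀ P D a b, P.Nodup → (∀ z ∈ P, z ∈ K) → P ≠ [] → PathL G a b D → G.Adj b a →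
      (T ++ W ++ P).Perm D → False := by
    intro P D a b hPn hPK hPne hD hba hp
    have hn := nodup_append_of_forall_mem hTWn hPn hPK hKTW
    have hlen := hp.length_eq
    have hlen' := hTW.perm.length_eq
    have hPl := List.length_pos_iff.2 hPne
    rw [List.length_append, hlen'] at hlen
    have := hO.cyc.three_le
    have := hO.max D (CycL.mk' hD hba (hp.nodup_iff.1 hn) (by omega))
    omega
  obtain ⟨W, rfl⟩ := hW.eq_cons
  rcases W with _ | ⟨c, M⟩
  · exact hss' (by simpa using hW.last)
  have hc : C.formPerm s' = c := formPerm_eq_of_consecutive (X := T) hCn hTW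
  obtain ⟨-, hM, hs'c⟩ := PathL.split (X := []) hW
  obtain ⟨Q, w, R, hQ, hQp, hw⟩ := exists_split_first (fun w => G.Adj z w ∧ w ∉ S) (c :: M)
    ⟨s, hM.last_mem, fun h => h.2 hs⟩
  have hcS : c ∉ S := hc ▸ hO.formPerm_notMem_attach hs'
  rcases Q with _ | ⟨c', Q⟩
  · simp only [List.nil_append, List.cons.injEq] at hQ
    exact absurd ⟨hc ▸ hzs', hcS⟩ (hQ.1 ▸ hw)
  obtain rfl : c = c' := by simpa using congrArg List.head? hQ
  rw [hQ] at hM hW hTW hTWn hSW hKTW long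
  obtain ⟨Q', e, hQe⟩ : ∃ Q' e, c :: Q = Q' ++ [e] := by
    rcases (c :: Q).eq_nil_or_concat with h | ⟨Q', e, h⟩
    · simp at h
    · exact ⟨Q', e, by simpa using h⟩
  have hM' := hM
  rw [hQe, List.append_assoc, List.singleton_append] at hM'
  obtain ⟨hce, hws, -⟩ := hM'.split
  rw [← hQe] at hce
  have heQ : e ∈ c :: Q := by rw [hQe]; simp
  have hew : C.formPerm e = w := by
    refine formPerm_eq_of_consecutive (X := T ++ s' :: Q') (Y := R) hCn ?_
    rw [hQe] at hTW
    simpa using hTW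
  -- With e the predecessor of w, this path a…z e…s'⁺ s' covers T and everything from s' to e, and
  -- can leave s' by an ear.
  have hU : PathL G a s' (T ++ (c :: Q).reverse ++ [s']) :=
    (hT.append hce.reverse (hQp e heQ).1).append (.single s') hs'c.symm
  have hcount : ∀ (P : List V) (v : V), (T ++ s' :: (c :: Q ++ w :: R) ++ P).count v =
      T.count v + [s'].count v + (c :: Q).count v + (w :: R).count v + P.count v := by
    intro P v
    rw [show s' :: (c :: Q ++ w :: R) = [s'] ++ (c :: Q) ++ (w :: R) by simp]
    simp only [List.count_append]
    omega
  by_cases hwS : w ∈ S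
  · obtain ⟨P, p, q, hP, hPn, hPK, h1, h2⟩ :=
      hO.linked.exists_ear (mem_attach.1 hs').2 (mem_attach.1 hwS).2
    refine long P _ _ _ hPn hPK hP.ne_nil ((hU.append hP h1).append hws h2) hsa
      (List.perm_iff_count.2 fun v => ?_)
    rw [hcount]
    simp only [List.count_append, List.count_reverse]
    omega
  have hzw : ¬ G.Adj z w := fun h => hw ⟨h, hwS⟩
  have hwC : w ∈ C := by rw [← hTW.perm.mem_iff]; simp
  -- The vertex w is outside the exchanged set, since its predecessor e is not in S; its neighbour
  -- there can only be d⁺ with d ≠ s' in S.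
  have hI' := hI.exchange (a := c) (b := z) (by
    intro u hu huc hzu
    rcases Finset.mem_insert.1 hu with rfl | hu
    · exact hzxa u hx hzu
    · obtain ⟨t, ht, rfl⟩ := Finset.mem_image.1 hu
      exact huc (only t ht hzu ▸ hc))
  have hIc' := card_exchange (I := insert x (S.image C.formPerm)) (a := c) (b := z)
    (by simp only [Finset.mem_insert, Finset.mem_image]; exact .inr ⟨s', hs', hc⟩) hzI
  obtain ⟨u, hu, hwu⟩ := exists_adj_of_indepNum_le hα hI' (by omega) (v := w) (by
    simp only [Finset.mem_insert, Finset.mem_erase, Finset.mem_image, not_or, not_and]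
    refine ⟨?_, fun _ => ⟨fun h => hO.notMem x hx (h ▸ hwC), ?_⟩⟩
    · rintro rfl
      exact (List.nodup_append.1 hTWn).2.2 w hzT w (by simp) rfl
    · rintro ⟨t, ht, htw⟩
      obtain rfl : t = e := C.formPerm.injective (htw.trans hew.symm)
      exact (hQp t heQ).2 ht)
  simp only [Finset.mem_insert, Finset.mem_erase, Finset.mem_image] at hu
  rcases hu with rfl | ⟨huc, rfl | ⟨d, hd, rfl⟩⟩
  · exact hzw hwu.symm
  · exact hwS (mem_attach.2 ⟨hwC, u, hx, hwu⟩)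
  have hds' : d ≠ s' := by rintro rfl; exact huc hc
  obtain ⟨P, p, q, hP, hPn, hPK, h1, h2⟩ :=
    hO.linked.exists_ear (mem_attach.1 hs').2 (mem_attach.1 hd).2
  have hdR : d ∈ w :: R := by
    have := hSW d hd
    rw [List.mem_cons, List.mem_append] at this
    rcases this with h | h | h
    · exact absurd h hds'
    · exact absurd hd (hQp d h).2
    · exact h
  by_cases hds : d = s
  · subst hds
    refine long P _ _ _ hPn hPK hP.ne_nil ((hU.append hP h1).append hws.reverse h2) (hσs ▸ hwu)
      (List.perm_iff_count.2 fun v => ?_)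
    rw [hcount]
    simp only [List.count_append, List.count_reverse]
    omega
  -- With g = d⁺, the longer cycle is g…s, then a…z e…s', then an ear to d, then d…w, closed by w ~
  -- g.
  · obtain ⟨R₁, g, R₂, hR⟩ := hws.exists_split hdR hds
    rw [hR] at hws hTW hcount
    obtain ⟨hR₁, hR₂, -⟩ := hws.split
    have hdg : C.formPerm d = g :=
      formPerm_eq_of_consecutive (X := T ++ s' :: (c :: Q) ++ R₁) (Y := R₂) hCn (by simpa using hTW)
    refine long P _ _ _ hPn hPK hP.ne_nil
      (((hR₂.append hU hsa).append hP h1).append hR₁.reverse h2) (hdg ▸ hwu)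
      (List.perm_iff_count.2 fun v => ?_)
    rw [hR, hcount, show R₁ ++ d :: g :: R₂ = R₁ ++ [d] ++ g :: R₂ by simp]
    simp only [List.count_append, List.count_reverse]
    omega

end OffLongest

end SimpleGraph

/-! ### Ears through all of K and assembly of the 2-factor. -/

namespace SimpleGraph

variable {V : Type*} {G : SimpleGraph V} {a b c d s s' t u v x y z : V} {A B C T W X Y : List V}
  {K I : Finset V} [DecidableEq V]

namespace OffLongest

theorem attach_nonempty (hO : OffLongest G C K) (hG : G.Connected) (hx : x ∈ K)
    (hcov : ∀ v, v ∈ C ∨ v ∈ K) : (attach G C K).Nonempty := by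
  obtain ⟨a, _, hp, -⟩ := hO.cyc.closed
  obtain ⟨p⟩ := hG.preconnected x a
  obtain ⟨d, -, h1, h2⟩ := p.exists_boundary_dart (K : Set V) hx
    fun h => hO.notMem a h hp.head_mem
  exact ⟨d.snd, mem_attach.2 ⟨(hcov _).resolve_right h2, d.fst, h1, d.adj.symm⟩⟩

theorem adj_of_mem (hO : OffLongest G C K) [Fintype V]
    (hα : G.indepNum ≤ (attach G C K).card + 1) (hx : x ∈ K) (hy : y ∈ K) (hxy : x ≠ y) :
    G.Adj x y := by
  obtain ⟨u, hu, hyu⟩ := exists_adj_of_indepNum_le hα (hO.isIndepSet_insert_image hx)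
    (hO.card_insert_image hx).ge (v := y) (by
      simp only [Finset.mem_insert, Finset.mem_image, not_or, not_exists, not_and]
      refine ⟨hxy.symm, ?_⟩
      rintro s hs rfl
      exact hO.notMem _ hy (CycL.formPerm_mem (mem_attach.1 hs).1))
  rcases Finset.mem_insert.1 hu with rfl | hu
  · exact hyu.symm
  · obtain ⟨s, hs, rfl⟩ := Finset.mem_image.1 hu
    exact absurd (mem_attach.2 ⟨CycL.formPerm_mem (mem_attach.1 hs).1, y, hy, hyu.symm⟩)
      (hO.formPerm_notMem_attach hs)

/-- A vertex of `K` is adjacent to almost all vertices of `C` having a neighbour in `K`. -/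
theorem degree_add_card_le [Fintype V] [DecidableRel G.Adj]
    (hcov : ∀ v, v ∈ C ∨ v ∈ K) (hx : x ∈ K) {Z : Finset V} (hZ : Z ⊆ attach G C K)
    (hxZ : ∀ z ∈ Z, ¬ G.Adj x z) :
    G.degree x + Z.card + 1 ≤ (attach G C K).card + K.card := by
  have hsub : G.neighborFinset x ⊆ (attach G C K \ Z) ∪ K.erase x := by
    intro y hy
    rw [mem_neighborFinset] at hy
    rw [Finset.mem_union, Finset.mem_sdiff, Finset.mem_erase]
    by_cases hyK : y ∈ K
    · exact .inr ⟨hy.ne', hyK⟩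
    · exact .inl ⟨mem_attach.2 ⟨(hcov y).resolve_right hyK, x, hx, hy.symm⟩, fun h => hxZ y h hy⟩
  have h1 := (Finset.card_le_card hsub).trans (Finset.card_union_le _ _)
  rw [Finset.card_sdiff_of_subset hZ, Finset.card_erase_of_mem hx, card_neighborFinset_eq_degree]
    at h1
  have := Finset.card_le_card hZ
  have := Finset.card_pos.2 ⟨x, hx⟩
  omega

/-- For K = {x, y}, a vertex of K missing both s and t would have too small a degree; so s and t can
be matched to different ends of the edge xy. When s = t the ear needs two vertices, to close a cycle
with s alone; the degree bound 2 excludes |K| = 1. -/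
theorem exists_spanning_ear (hO : OffLongest G C K) [Fintype V] [DecidableRel G.Adj]
    (hcov : ∀ v, v ∈ C ∨ v ∈ K) (hα : G.indepNum ≤ (attach G C K).card + 1)
    (hdeg : ∀ x, (attach G C K).card ≤ G.degree x) (hdeg' : ∀ x, 2 ≤ G.degree x)
    (hx : x ∈ K) (hcard : K.card < 3) (hs : s ∈ attach G C K) (ht : t ∈ attach G C K)
    (hst : s = t → attach G C K = {s}) :
    ∃ P p q, PathL G p q P ∧ P.Nodup ∧ (∀ z, z ∈ P ↔ z ∈ K) ∧ G.Adj s p ∧ G.Adj q t ∧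
      (s = t → 2 ≤ P.length) := by
  by_cases hK1 : K = {x}
  · subst hK1
    have hsx : G.Adj s x := by simpa using (mem_attach.1 hs).2
    have htx : G.Adj t x := by simpa using (mem_attach.1 ht).2
    refine ⟨[x], x, x, .single x, by simp, by simp, hsx, htx.symm, fun h => ?_⟩
    have h1 := degree_add_card_le hcov hx (Finset.empty_subset _) (by simp) (G := G)
    have h2 := hdeg' x
    rw [hst h] at h1
    simp at h1
    omega
  · obtain ⟨y, hy, hyx⟩ : ∃ y ∈ K, y ≠ x := by
      by_contra! h
      exact hK1 (Finset.eq_singleton_iff_unique_mem.2 ⟨hx, h⟩)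
    have hxy := hO.adj_of_mem hα hx hy hyx.symm
    have hKxy : K = {x, y} := by
      refine (Finset.eq_of_subset_of_card_le ?_ ?_).symm
      · simp [Finset.insert_subset_iff, hx, hy]
      · rw [Finset.card_pair hyx.symm]; omega
    have hadj : ∀ r ∈ attach G C K, G.Adj r x ∨ G.Adj r y := by
      intro r hr
      have := (mem_attach.1 hr).2
      rw [hKxy] at this
      simpa using this
    have hmiss : ∀ w ∈ K, G.Adj s w ∨ G.Adj t w := by
      intro w hw
      by_contra! hno
      have h1 := degree_add_card_le hcov hw (Z := {s, t}) (G := G)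
        (by simp [Finset.insert_subset_iff, hs, ht])
        (by simpa [G.adj_comm w] using hno)
      by_cases h : s = t
      · rw [hst h] at h1
        have := hdeg' w
        simp [h] at h1
        omega
      · rw [Finset.card_pair h] at h1
        have := hdeg w
        omega
    have hmem : ∀ z, z ∈ [x, y] ↔ z ∈ K := by simp [hKxy]
    have hmem' : ∀ z, z ∈ [y, x] ↔ z ∈ K := by simp [hKxy, or_comm]
    have hP : PathL G x y [x, y] := (PathL.single x).append (.single y) hxy
    have hP' : PathL G y x [y, x] := (PathL.single y).append (.single x) hxy.symm
    have key : (G.Adj s x ∧ G.Adj t y) ∨ (G.Adj s y ∧ G.Adj t x) := by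
      have h1 := hmiss x hx
      have h2 := hmiss y hy
      have h3 := hadj s hs
      have h4 := hadj t ht
      tauto
    rcases key with ⟨h1, h2⟩ | ⟨h1, h2⟩
    · exact ⟨_, x, y, hP, by simp [hyx.symm], hmem, h1, h2.symm, by simp⟩
    · exact ⟨_, y, x, hP', by simp [hyx], hmem', h1, h2.symm, by simp⟩

theorem exists_isTwoFactor [Fintype V] [DecidableRel G.Adj] (hO : OffLongest G C K)
    (hG : G.Connected) (hcov : ∀ v, v ∈ C ∨ v ∈ K) (hα : G.indepNum ≤ (attach G C K).card + 1)
    (hdeg : ∀ x, (attach G C K).card ≤ G.degree x) (hdeg' : ∀ x, 2 ≤ G.degree x)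
    (hcard : 3 * (attach G C K).card + 3 ≤ Fintype.card V) (hx : x ∈ K) :
    ∃ H : SimpleGraph V, G.IsTwoFactor H ∧ Nat.card H.ConnectedComponent = 2 := by
  by_cases hK3 : 3 ≤ K.card
  · refine exists_isTwoFactor_of_cycL hO.cyc
      (cycL_toList (fun x hx y hy => hO.adj_of_mem hα hx hy) hK3)
      (nodup_append_of_forall_mem hO.cyc.nodup K.nodup_toList (by simp) hO.notMem)
      (by simpa using hcov)
  push Not at hK3
  have hCcard : Fintype.card V ≤ C.length + K.card := by
    have : (Finset.univ : Finset V) ⊆ C.toFinset ∪ K := by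
      intro v _
      simpa using hcov v
    calc Fintype.card V = (Finset.univ : Finset V).card := Finset.card_univ.symm
      _ ≤ _ := (Finset.card_le_card this).trans (Finset.card_union_le _ _)
      _ = C.length + K.card := by rw [List.toFinset_card_of_nodup hO.cyc.nodup]
  obtain ⟨T, W, a, z, s', s, hTW, hT, hW, hzs, hsa, hs, hs', hTS, h3⟩ :=
    hO.exists_segment (hO.attach_nonempty hG hx hcov) (by omega)
  have hTWn := hTW.perm.nodup_iff.2 hO.cyc.nodup
  have hss : s = s' → attach G C K = {s} ∧ W = [s] := by
    rintro rfl
    have hW1 : W = [s] := by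
      obtain ⟨W, rfl⟩ := hW.eq_cons
      rcases W.eq_nil_or_concat with rfl | ⟨W, r, rfl⟩
      · rfl
      · have h1 := hW.last
        have h2 := (List.nodup_append.1 hTWn).2.1
        simp [List.getLast?_cons] at h1
        simp [h1] at h2
    refine ⟨Finset.eq_singleton_iff_unique_mem.2 ⟨hs, fun t ht => ?_⟩, hW1⟩
    have := (mem_attach.1 ht).1
    rw [← hTW.perm.mem_iff, List.mem_append, hW1] at this
    exact List.mem_singleton.1 (this.resolve_left fun h => hTS t h ht)
  have hmain := hO.ends_adj_or_exists_isTwoFactor hx hcov hα (by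
      intro s hs t ht hst
      obtain ⟨P, p, q, h1, h2, h3, h4, h5, -⟩ := hO.exists_spanning_ear hcov hα hdeg hdeg' hx hK3
        hs ht (fun h => absurd h hst)
      exact ⟨P, p, q, h1, h2, h3, h4, h5⟩) hTW hT hW hzs hsa hs hs' hTS h3
  refine hmain.elim (fun hza => ?_) id
  obtain ⟨P, p, q, hP, hPn, hPK, h1, h2, h4⟩ := hO.exists_spanning_ear hcov hα hdeg hdeg' hx hK3
    hs hs' (fun h => (hss h).1)
  have hn := nodup_append_of_forall_mem hTWn hPn (fun z hz => (hPK z).1 hz)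
    (by simpa only [hTW.perm.mem_iff] using hO.notMem)
  have hPl := List.length_pos_iff.2 hP.ne_nil
  have hlen : 3 ≤ (W ++ P).length := by
    rw [List.length_append]
    by_cases h : s = s'
    · have := h4 h
      simp [(hss h).2]
      omega
    · obtain ⟨W, rfl⟩ := hW.eq_cons
      cases W with
      | nil => exact absurd (by simpa using hW.last.symm) h
      | cons r W => simp; omega
  rw [List.append_assoc] at hn
  refine exists_isTwoFactor_of_cycL (CycL.mk' hT hza (List.nodup_append.1 hn).1 h3)
    (CycL.mk' (hW.append hP h1) h2 (List.nodup_append.1 hn).2.1 hlen) hn fun v => ?_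
  rw [← List.append_assoc, List.mem_append, hTW.perm.mem_iff, hPK]
  exact hcov v

end OffLongest

end SimpleGraph

open SimpleGraph in
theorem corollary1p8 {V : Type*} [Fintype V] [DecidableEq V] (G : SimpleGraph V)
    [DecidableRel G.Adj] (hconn : G.Connected) (hham : ¬ G.IsHamiltonian)
    (hcard : 3 * G.vertexConnectivity + 3 ≤ Fintype.card V) (hdeg : 2 ≤ G.minDegree)
    (hα : G.indepNum ≤ G.vertexConnectivity + 1) :
    ∃ H : SimpleGraph V, G.IsTwoFactor H ∧ Nat.card H.ConnectedComponent = 2 := by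
  have := hconn.nonempty
  obtain ⟨C₀, hC₀, hmax⟩ := exists_maximal_of_le (fun _ h => CycL.length_le h) (exists_cycL hdeg)
  obtain ⟨v, hv⟩ : ∃ v, v ∉ C₀ := by
    by_contra! h
    exact hham (hC₀.isHamiltonian h)
  obtain ⟨⟨C, K⟩, ⟨⟨x, hx⟩, hO⟩, hm⟩ := exists_maximal_of_le
    (P := fun p : List V × Finset V => p.2.Nonempty ∧ OffLongest G p.1 p.2)
    (f := fun p => p.2.card) (N := Fintype.card V) (fun p _ => p.2.card_le_univ)
    ⟨(C₀, {v}), by simp, hC₀, hmax, linked_singleton v, by simpa using hv⟩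
  replace hO : OffLongest G C K := hO
  have hm' : ∀ C' K', OffLongest G C' K' → K'.card ≤ K.card := by
    intro C' K' h
    rcases K'.eq_empty_or_nonempty with rfl | hne
    · simp
    · exact hm (C', K') ⟨hne, h⟩
  have hcov := hO.covers hx hm' hα
  -- The upper bound is |S| + 1 ≤ α ≤ κ + 1, from the independent set S⁺ ∪ {x}.
  have hκ : (attach G C K).card = G.vertexConnectivity := by
    refine le_antisymm ?_ (hO.vertexConnectivity_le_card_attach hx fun _ _ y _ => (hcov y).symm)
    have h1 := hO.card_insert_image hx
    have h2 := (hO.isIndepSet_insert_image hx).card_le_indepNum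
    omega
  exact hO.exists_isTwoFactor hconn hcov (hκ ▸ hα) (fun x => hκ ▸ vertexConnectivity_le_degree x)
    (fun x => hdeg.trans (G.minDegree_le_degree x)) (hκ ▸ hcard) hx
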